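/- Let $q$ be a complex number with $0<|q|<1$, and write $(x;q)_n=\prod_{i=0}^{n-1}(1-q^ix)$. For $a\in\mathbb Z$ put $$\Theta_a(q)=\sum_{n=0}^{\infty}(-1)^nq^{an}q^{15\binom{n+1}{2}}.$$ The fifth order mock theta functions $\chi_0,\chi_1$ have the Eulerian forms $$\chi_0(q)=\sum_{n\ge0}\frac{q^n}{(q^{n+1};q)_n}=1+\sum_{n\ge0}\frac{q^{2n+1}}{(q^{n+1};q)_{n+1}},\qquad \chi_1(q)=\sum_{n\ge0}\frac{q^n}{(q^{n+1};q)_{n+1}}.$$ Replacing $q$ by $q^{-1}$ in each summand turns these three forms, term by term, into the series on the left-hand sides below. All series below (including those defining $\Theta_a(q)$) converge absolutely, and $$\sum_{n=0}^{\infty}\frac{(-1)^nq^{3n^2/2-n/2}}{(q^{n+1};q)_n}=2-\Theta_{-7}(q)-q^7\Theta_7(q)-q\,\Theta_{-2}(q)-q^3\Theta_2(q),$$ $$1+\sum_{n=0}^{\infty}\frac{(-1)^{n+1}q^{3n^2/2+n/2}}{(q^{n+1};q)_{n+1}}=1-\Theta_{-7}(q)-q^7\Theta_7(q)-q\,\Theta_{-2}(q)-q^3\Theta_2(q),$$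 $$\sum_{n=0}^{\infty}\frac{(-1)^{n+1}q^{3\binom{n+1}{2}+1}}{(q^{n+1};q)_{n+1}}=-q\,\Theta_{-4}(q)-q^5\Theta_4(q)-q^2\Theta_{-1}(q)-q^3\Theta_1(q).$$ -/

import Mathlib

noncomputable section

/-- The finite q-Pochhammer symbol `(x; q)_n = ∏_{i=0}^{n-1} (1 - q^i x)`. -/
def qPoch (x q : ℂ) (n : ℕ) : ℂ :=
  ∏ i ∈ Finset.range n, (1 - q ^ i * x)

/-- Summand of the first Eulerian form `χ₀(q) = ∑ q^n / (q^{n+1}; q)_n`. -/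
def chi0TermA (q : ℂ) (n : ℕ) : ℂ :=
  q ^ n / qPoch (q ^ (n + 1)) q n

/-- Summand of the second Eulerian form `χ₀(q) = 1 + ∑ q^{2n+1} / (q^{n+1}; q)_{n+1}`. -/
def chi0TermB (q : ℂ) (n : ℕ) : ℂ :=
  q ^ (2 * n + 1) / qPoch (q ^ (n + 1)) q (n + 1)

/-- Summand of the first Eulerian form `χ₁(q) = ∑ q^n / (q^{n+1}; q)_{n+1}`. -/
def chi1TermA (q : ℂ) (n : ℕ) : ℂ :=
  q ^ n / qPoch (q ^ (n + 1)) q (n + 1)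

/-- Summand of the dual `∑ (-1)^n q^{3n²/2 - n/2} / (q^{n+1}; q)_n`;
the exponent `(3n² - n)/2` is an exact integer division. -/
def chi0DualTermA (q : ℂ) (n : ℕ) : ℂ :=
  (-1) ^ n * q ^ ((3 * (n : ℤ) ^ 2 - n) / 2) / qPoch (q ^ (n + 1)) q n

/-- Summand of the dual `1 + ∑ (-1)^{n+1} q^{3n²/2 + n/2} / (q^{n+1}; q)_{n+1}`;
the exponent `(3n² + n)/2` is an exact integer division. -/
def chi0DualTermB (q : ℂ) (n : ℕ) : ℂ :=
  (-1) ^ (n + 1) * q ^ ((3 * (n : ℤ) ^ 2 + n) / 2) / qPoch (q ^ (n + 1)) q (n + 1)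

/-- Summand of the dual `∑ (-1)^{n+1} q^{3 binom(n+1,2) + 1} / (q^{n+1}; q)_{n+1}`. -/
def chi1DualTermA (q : ℂ) (n : ℕ) : ℂ :=
  (-1) ^ (n + 1) * q ^ (3 * (n + 1).choose 2 + 1) / qPoch (q ^ (n + 1)) q (n + 1)

/-- Summand `(-1)^n q^{an} q^{15 binom(n+1,2)}` of a partial theta function, `a ∈ ℤ`. -/
def partialThetaTerm (a : ℤ) (q : ℂ) (n : ℕ) : ℂ :=
  (-1) ^ n * q ^ (a * (n : ℤ)) * q ^ (15 * (n + 1).choose 2)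

/-- The partial theta function `∑_{n ≥ 0} (-1)^n q^{an} q^{15 binom(n+1,2)}`. -/
def partialTheta (a : ℤ) (q : ℂ) : ℂ :=
  ∑' n : ℕ, partialThetaTerm a q n

end

/-!
The two series with denominators `(q^{n+1}; q)_{n+1}` are evaluated by the Bailey lemma. Up to sign
and a factor `q` their summands are `w_n β_n`, where `w_n = (-1)^n q^{n(n+1)/2} (q; q)_n`
(`weight`) and `β_n` is `q^{n²} / (q; q)_{2n+1}` or `q^{n²+n} / (q; q)_{2n+1}`.

Both `β_n` expand in the kernel `f_n(r) = 1 / ((q; q)_{n-r} (q; q)_{n+r+1})`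
(`oddSumA_closed`, `oddSumB_closed`):
`q^{n²} / (q; q)_{2n+1} = ∑_{i ∈ ℤ} (q^{3i²-i} f_n(3i) - q^{3i²+i} f_n(3i+1))` and
`q^{n²+n} / (q; q)_{2n+1} = ∑_{i ∈ ℤ} q^{3i²+2i} (f_n(3i) - f_n(3i+1))`.
The `q`-Pascal rule and the reflections `r ↦ -r` and `r ↦ -r - 1` of the kernels link these sums
to the corresponding sum over even Gaussian binomials (`evenSum`) and give it the recursion
`(1 - q^{2n+1}) (1 - q^{2n+2}) E_{n+1} = q^{2n+1} E_n`.

On the other side `∑_n w_n f_n(r) = (-1)^r q^{r(r+1)/2}` for `r ≥ 0` (`conjSum_natCast`), by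
creative telescoping in `r`. The double series converges absolutely, because `(q; q)_n` and its
inverse are bounded and `|w_n|` decays geometrically; interchanging the summations turns the series
into bilateral sums of `± q^{3i²+…} q^{r(r+1)/2}` with `r = 3i` or `r = 3i + 1`, and the two halves
of each bilateral sum are partial theta functions with `15 n(n+1)/2` in the exponent.

The series with denominators `(q^{n+1}; q)_n` exceeds the one with `(q^{n+1}; q)_{n+1}` and
`β_n = q^{n²} / (q; q)_{2n+1}` by a telescoping series with sum `2` (`chi0DualTermA_sub_chi0DualTermB`).
-/

open Filter Topology

/-! ### The `q`-Pochhammer symbol and its reciprocal -/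

theorem qPoch_succ (x q : ℂ) (n : ℕ) : qPoch x q (n + 1) = qPoch x q n * (1 - q ^ n * x) :=
  Finset.prod_range_succ _ _

@[simp] theorem qPoch_zero (x q : ℂ) : qPoch x q 0 = 1 := by
  simp [qPoch]

theorem qPoch_self_succ (q : ℂ) (n : ℕ) :
    qPoch q q (n + 1) = qPoch q q n * (1 - q ^ (n + 1)) := by
  rw [qPoch_succ, pow_succ]

theorem qPoch_self_mul (q : ℂ) (n m : ℕ) :
    qPoch q q n * qPoch (q ^ (n + 1)) q m = qPoch q q (n + m) := by
  induction m with
  | zero => simp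
  | succ m ih =>
    rw [qPoch_succ, ← mul_assoc, ih, ← add_assoc, qPoch_self_succ]
    ring

theorem one_sub_pow_ne_zero {q : ℂ} (hq1 : ‖q‖ < 1) {n : ℕ} (hn : n ≠ 0) : 1 - q ^ n ≠ 0 := by
  intro h
  have h1 : ‖q ^ n‖ = 1 := by rw [← sub_eq_zero.mp h]; simp
  rw [norm_pow] at h1
  exact (pow_lt_one₀ (norm_nonneg q) hq1 hn).ne h1

theorem qPoch_self_ne_zero {q : ℂ} (hq1 : ‖q‖ < 1) (n : ℕ) : qPoch q q n ≠ 0 := by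
  induction n with
  | zero => simp
  | succ n ih =>
    rw [qPoch_self_succ]
    exact mul_ne_zero ih (one_sub_pow_ne_zero hq1 n.succ_ne_zero)

theorem qPoch_pow_ne_zero {q : ℂ} (hq1 : ‖q‖ < 1) (n m : ℕ) : qPoch (q ^ (n + 1)) q m ≠ 0 := by
  intro h
  have := qPoch_self_mul q n m
  rw [h, mul_zero] at this
  exact qPoch_self_ne_zero hq1 _ this.symm

/-- `(q; q)_n` converges to the nonzero limit `(q; q)_∞`, so it is bounded above and away
from zero. -/
theorem exists_qPoch_self_bound {q : ℂ} (hq1 : ‖q‖ < 1) :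
    ∃ K : ℝ, 0 < K ∧ ∀ n, ‖qPoch q q n‖ ≤ K ∧ ‖(qPoch q q n)⁻¹‖ ≤ K := by
  have hs : Summable fun i : ℕ => ‖-q ^ (i + 1)‖ := by
    simp only [norm_neg, norm_pow]
    exact (summable_nat_add_iff 1).mpr (summable_geometric_of_lt_one (norm_nonneg q) hq1)
  have hm : Multipliable fun i : ℕ => 1 + -q ^ (i + 1) := multipliable_one_add_of_summable hs
  have hne : ∏' i : ℕ, (1 + -q ^ (i + 1)) ≠ 0 := by
    refine tprod_one_add_ne_zero_of_summable (fun i => ?_) hs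
    rw [← sub_eq_add_neg]
    exact one_sub_pow_ne_zero hq1 i.succ_ne_zero
  have ht : Tendsto (fun n => qPoch q q n) atTop (𝓝 (∏' i : ℕ, (1 + -q ^ (i + 1)))) := by
    refine hm.hasProd.tendsto_prod_nat.congr fun n => ?_
    simp only [qPoch, ← sub_eq_add_neg, pow_succ]
  obtain ⟨K₁, h₁⟩ := (Metric.isBounded_range_of_tendsto _ ht).exists_norm_le
  obtain ⟨K₂, h₂⟩ := (Metric.isBounded_range_of_tendsto _ (ht.inv₀ hne)).exists_norm_le
  refine ⟨max 1 (max K₁ K₂), by positivity, fun n => ⟨?_, ?_⟩⟩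
  · exact (h₁ _ ⟨n, rfl⟩).trans ((le_max_left _ _).trans (le_max_right _ _))
  · exact (h₂ _ ⟨n, rfl⟩).trans ((le_max_right _ _).trans (le_max_right _ _))

/-- `1 / (q; q)_k` for an integer `k`, with the value `0` at negative `k`. -/
noncomputable def recipPoch (q : ℂ) (k : ℤ) : ℂ :=
  if 0 ≤ k then (qPoch q q k.toNat)⁻¹ else 0

@[simp] theorem recipPoch_natCast (q : ℂ) (n : ℕ) : recipPoch q n = (qPoch q q n)⁻¹ := by
  simp [recipPoch]

theorem recipPoch_of_neg (q : ℂ) {k : ℤ} (hk : k < 0) : recipPoch q k = 0 := by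
  simp [recipPoch, hk.not_ge]

/-- The recursion of `1 / (q; q)_k` holds at every integer: at `k = 0` both sides vanish. -/
theorem recipPoch_sub_one {q : ℂ} (hq1 : ‖q‖ < 1) (k : ℤ) :
    recipPoch q (k - 1) = (1 - q ^ k) * recipPoch q k := by
  rcases lt_trichotomy k 0 with hk | rfl | hk
  · rw [recipPoch_of_neg q hk, recipPoch_of_neg q (by omega), mul_zero]
  · rw [recipPoch_of_neg q (by omega)]; simp
  · obtain ⟨n, rfl⟩ : ∃ n : ℕ, k = ((n + 1 : ℕ) : ℤ) := ⟨(k - 1).toNat, by omega⟩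
    have h1 : ((n + 1 : ℕ) : ℤ) - 1 = (n : ℤ) := by push_cast; ring
    rw [h1, recipPoch_natCast, recipPoch_natCast, zpow_natCast, qPoch_self_succ]
    field_simp [qPoch_self_ne_zero hq1 n, one_sub_pow_ne_zero hq1 n.succ_ne_zero]

theorem exists_recipPoch_bound {q : ℂ} (hq1 : ‖q‖ < 1) :
    ∃ K : ℝ, 0 < K ∧ (∀ n, ‖qPoch q q n‖ ≤ K) ∧ ∀ k, ‖recipPoch q k‖ ≤ K := by
  obtain ⟨K, hK, h⟩ := exists_qPoch_self_bound hq1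
  refine ⟨K, hK, fun n => (h n).1, fun k => ?_⟩
  unfold recipPoch
  split_ifs
  · exact (h _).2
  · simpa using hK.le

/-- The `q`-Pascal rule, for `1 / ((q; q)_a (q; q)_b)` instead of a Gaussian binomial. -/
theorem recipPoch_pascal {q : ℂ} (hq0 : q ≠ 0) (hq1 : ‖q‖ < 1) (a b : ℤ) :
    (1 - q ^ (a + b)) * (recipPoch q a * recipPoch q b) =
      recipPoch q a * recipPoch q (b - 1) + q ^ b * (recipPoch q (a - 1) * recipPoch q b) := by
  rw [recipPoch_sub_one hq1, recipPoch_sub_one hq1, zpow_add₀ hq0]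
  ring

/-! ### The Gaussian kernels -/

/-- `1 / ((q; q)_{n-r} (q; q)_{n+r})`, the Gaussian binomial `[2n, n-r]` divided by
`(q; q)_{2n}`. -/
noncomputable def evenKernel (q : ℂ) (n : ℕ) (r : ℤ) : ℂ :=
  recipPoch q (n - r) * recipPoch q (n + r)

/-- `1 / ((q; q)_{n-r} (q; q)_{n+r+1})`, the Gaussian binomial `[2n+1, n-r]` divided by
`(q; q)_{2n+1}`. -/
noncomputable def oddKernel (q : ℂ) (n : ℕ) (r : ℤ) : ℂ :=
  recipPoch q (n - r) * recipPoch q (n + r + 1)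

theorem evenKernel_neg (q : ℂ) (n : ℕ) (r : ℤ) : evenKernel q n (-r) = evenKernel q n r := by
  simp only [evenKernel, sub_neg_eq_add, ← sub_eq_add_neg, mul_comm]

theorem oddKernel_neg (q : ℂ) (n : ℕ) (r : ℤ) :
    oddKernel q n (-r - 1) = oddKernel q n r := by
  rw [oddKernel, oddKernel, mul_comm]
  congr 2 <;> ring

theorem evenKernel_eq_zero (q : ℂ) {n : ℕ} {r : ℤ} (h : (n : ℤ) < |r|) :
    evenKernel q n r = 0 := by
  rcases lt_abs.mp h with h | h
  · rw [evenKernel, recipPoch_of_neg q (by omega), zero_mul]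
  · rw [evenKernel, recipPoch_of_neg q (k := n + r) (by omega), mul_zero]

theorem oddKernel_eq_zero (q : ℂ) {n : ℕ} {r : ℤ} (h : (n : ℤ) + 1 < |r|) :
    oddKernel q n r = 0 := by
  rcases lt_abs.mp h with h | h
  · rw [oddKernel, recipPoch_of_neg q (by omega), zero_mul]
  · rw [oddKernel, recipPoch_of_neg q (k := n + r + 1) (by omega), mul_zero]

theorem oddKernel_pascal {q : ℂ} (hq0 : q ≠ 0) (hq1 : ‖q‖ < 1) (n : ℕ) (r : ℤ) :
    (1 - q ^ (2 * n + 1)) * oddKernel q n r =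
      evenKernel q n r + q ^ (n + 1 + r) * evenKernel q n (r + 1) := by
  have h := recipPoch_pascal hq0 hq1 (n - r) (n + r + 1)
  rw [show (n : ℤ) - r + (n + r + 1) = ((2 * n + 1 : ℕ) : ℤ) by push_cast; ring,
    zpow_natCast] at h
  rw [oddKernel, evenKernel, evenKernel, h]
  congr 3 <;> ring_nf

/-- The other `q`-Pascal rule, obtained by the reflection `r ↦ -r - 1`. -/
theorem oddKernel_pascal' {q : ℂ} (hq0 : q ≠ 0) (hq1 : ‖q‖ < 1) (n : ℕ) (r : ℤ) :
    (1 - q ^ (2 * n + 1)) * oddKernel q n r =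
      q ^ (n - r) * evenKernel q n r + evenKernel q n (r + 1) := by
  have h := oddKernel_pascal hq0 hq1 n (-r - 1)
  rw [oddKernel_neg, show -r - 1 = -(r + 1) by ring, evenKernel_neg,
    show -(r + 1) + 1 = -r by ring, evenKernel_neg] at h
  rw [h, add_comm]
  congr 3; ring

theorem evenKernel_pascal {q : ℂ} (hq0 : q ≠ 0) (hq1 : ‖q‖ < 1) (n : ℕ) (r : ℤ) :
    (1 - q ^ (2 * n + 2)) * evenKernel q (n + 1) r =
      oddKernel q n (r - 1) + q ^ (n + 1 + r) * oddKernel q n r := by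
  have h := recipPoch_pascal hq0 hq1 (n + 1 - r) (n + 1 + r)
  rw [show (n : ℤ) + 1 - r + (n + 1 + r) = ((2 * n + 2 : ℕ) : ℤ) by push_cast; ring,
    zpow_natCast] at h
  rw [oddKernel, evenKernel, oddKernel, Nat.cast_succ, h]
  congr 3 <;> ring_nf

theorem summable_of_eq_zero_of_lt_abs {φ : ℤ → ℂ} (N : ℤ) (h : ∀ i, N < |i| → φ i = 0) :
    Summable φ := by
  refine summable_of_ne_finset_zero (s := Finset.Icc (-N) N) fun i hi => h i ?_
  by_contra hle
  exact hi (Finset.mem_Icc.mpr (abs_le.mp (not_lt.mp hle)))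

theorem summable_mul_evenKernel (q : ℂ) (c : ℤ → ℂ) (n : ℕ) (s : ℤ) :
    Summable fun i : ℤ => c i * evenKernel q n (3 * i + s) := by
  refine summable_of_eq_zero_of_lt_abs (n + |s|) fun i hi => ?_
  rw [evenKernel_eq_zero q (by grind), mul_zero]

theorem summable_mul_oddKernel (q : ℂ) (c : ℤ → ℂ) (n : ℕ) (s : ℤ) :
    Summable fun i : ℤ => c i * oddKernel q n (3 * i + s) := by
  refine summable_of_eq_zero_of_lt_abs (n + 1 + |s|) fun i hi => ?_
  rw [oddKernel_eq_zero q (by grind), mul_zero]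

/-! ### Two Bailey pairs modulo three -/

/-- `∑_{i ∈ ℤ} (q^{3i²-i} e(3i) - q^{3i²+i} e(3i+1))` for the kernel `e` of index `n`. -/
noncomputable def evenSum (q : ℂ) (n : ℕ) : ℂ :=
  ∑' i : ℤ, q ^ (3 * i ^ 2 - i) * evenKernel q n (3 * i + 0) -
    ∑' i : ℤ, q ^ (3 * i ^ 2 + i) * evenKernel q n (3 * i + 1)

/-- `∑_{i ∈ ℤ} (q^{3i²-i} f(3i) - q^{3i²+i} f(3i+1))` for the odd kernel `f` of index `n`. -/
noncomputable def oddSumA (q : ℂ) (n : ℕ) : ℂ :=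
  ∑' i : ℤ, q ^ (3 * i ^ 2 - i) * oddKernel q n (3 * i + 0) -
    ∑' i : ℤ, q ^ (3 * i ^ 2 + i) * oddKernel q n (3 * i + 1)

/-- `∑_{i ∈ ℤ} q^{3i²+2i} (f(3i) - f(3i+1))` for the odd kernel `f` of index `n`. -/
noncomputable def oddSumB (q : ℂ) (n : ℕ) : ℂ :=
  ∑' i : ℤ, q ^ (3 * i ^ 2 + 2 * i) * oddKernel q n (3 * i + 0) -
    ∑' i : ℤ, q ^ (3 * i ^ 2 + 2 * i) * oddKernel q n (3 * i + 1)

/-- Expanding the odd kernels by the `q`-Pascal rule yields `evenSum` and two further series, in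
`e(3i+1)` and `e(3i+2)`, that cancel under the reflection `i ↦ -1 - i`. -/
theorem oddSumA_eq {q : ℂ} (hq0 : q ≠ 0) (hq1 : ‖q‖ < 1) (n : ℕ) :
    (1 - q ^ (2 * n + 1)) * oddSumA q n = evenSum q n := by
  have hA : (1 - q ^ (2 * n + 1)) * ∑' i : ℤ, q ^ (3 * i ^ 2 - i) * oddKernel q n (3 * i + 0) =
      ∑' i : ℤ, q ^ (3 * i ^ 2 - i) * evenKernel q n (3 * i + 0) +
        ∑' i : ℤ, q ^ (n + 1 + 3 * i ^ 2 + 2 * i) * evenKernel q n (3 * i + 1) := by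
    rw [← tsum_mul_left, ← (summable_mul_evenKernel q _ n 0).tsum_add
      (summable_mul_evenKernel q _ n 1)]
    refine tsum_congr fun i => ?_
    rw [mul_left_comm, oddKernel_pascal hq0 hq1, mul_add, ← mul_assoc, ← zpow_add₀ hq0,
      add_zero]
    congr 3; ring
  have hB : (1 - q ^ (2 * n + 1)) * ∑' i : ℤ, q ^ (3 * i ^ 2 + i) * oddKernel q n (3 * i + 1) =
      ∑' i : ℤ, q ^ (3 * i ^ 2 + i) * evenKernel q n (3 * i + 1) +
        ∑' i : ℤ, q ^ (n + 2 + 3 * i ^ 2 + 4 * i) * evenKernel q n (3 * i + 2) := by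
    rw [← tsum_mul_left, ← (summable_mul_evenKernel q _ n 1).tsum_add
      (summable_mul_evenKernel q _ n 2)]
    refine tsum_congr fun i => ?_
    rw [mul_left_comm, oddKernel_pascal hq0 hq1, mul_add, ← mul_assoc, ← zpow_add₀ hq0]
    congr 3 <;> ring
  have hC : ∑' i : ℤ, q ^ (n + 2 + 3 * i ^ 2 + 4 * i) * evenKernel q n (3 * i + 2) =
      ∑' i : ℤ, q ^ (n + 1 + 3 * i ^ 2 + 2 * i) * evenKernel q n (3 * i + 1) := by
    rw [← (Equiv.subLeft (-1 : ℤ)).tsum_eq]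
    refine tsum_congr fun i => ?_
    rw [Equiv.subLeft_apply, ← evenKernel_neg]
    congr 2 <;> ring
  rw [oddSumA, evenSum, mul_sub, hA, hB, hC]
  ring

/-- Expanding `f(3i)` and `f(3i+1)` by different forms of the `q`-Pascal rule makes the terms
`q^{3i²+2i} e(3i+1)` cancel; the remaining series in `e(3i+2)` is the second series of `evenSum`
reflected by `i ↦ -1 - i`. -/
theorem oddSumB_eq {q : ℂ} (hq0 : q ≠ 0) (hq1 : ‖q‖ < 1) (n : ℕ) :
    (1 - q ^ (2 * n + 1)) * oddSumB q n = q ^ n * evenSum q n := by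
  have hA : (1 - q ^ (2 * n + 1)) *
      ∑' i : ℤ, q ^ (3 * i ^ 2 + 2 * i) * oddKernel q n (3 * i + 0) =
      q ^ n * ∑' i : ℤ, q ^ (3 * i ^ 2 - i) * evenKernel q n (3 * i + 0) +
        ∑' i : ℤ, q ^ (3 * i ^ 2 + 2 * i) * evenKernel q n (3 * i + 1) := by
    rw [← tsum_mul_left, ← tsum_mul_left, ← ((summable_mul_evenKernel q _ n 0).mul_left _).tsum_add
      (summable_mul_evenKernel q _ n 1)]
    refine tsum_congr fun i => ?_
    rw [mul_left_comm, oddKernel_pascal' hq0 hq1, mul_add, ← mul_assoc, ← zpow_add₀ hq0,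
      ← mul_assoc, ← zpow_natCast, ← zpow_add₀ hq0, add_zero]
    congr 3; ring
  have hB : (1 - q ^ (2 * n + 1)) *
      ∑' i : ℤ, q ^ (3 * i ^ 2 + 2 * i) * oddKernel q n (3 * i + 1) =
      ∑' i : ℤ, q ^ (3 * i ^ 2 + 2 * i) * evenKernel q n (3 * i + 1) +
        q ^ n * ∑' i : ℤ, q ^ (3 * i ^ 2 + 5 * i + 2) * evenKernel q n (3 * i + 2) := by
    rw [← tsum_mul_left, ← tsum_mul_left, ← (summable_mul_evenKernel q _ n 1).tsum_add
      ((summable_mul_evenKernel q _ n 2).mul_left _)]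
    refine tsum_congr fun i => ?_
    rw [mul_left_comm, oddKernel_pascal hq0 hq1, mul_add, ← mul_assoc, ← zpow_add₀ hq0,
      ← mul_assoc, ← zpow_natCast, ← zpow_add₀ hq0]
    congr 3 <;> ring
  have hC : ∑' i : ℤ, q ^ (3 * i ^ 2 + 5 * i + 2) * evenKernel q n (3 * i + 2) =
      ∑' i : ℤ, q ^ (3 * i ^ 2 + i) * evenKernel q n (3 * i + 1) := by
    rw [← (Equiv.subLeft (-1 : ℤ)).tsum_eq]
    refine tsum_congr fun i => ?_
    rw [Equiv.subLeft_apply, ← evenKernel_neg]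
    congr 2 <;> ring
  rw [oddSumB, evenSum, mul_sub, hA, hB, hC]
  ring

/-- Here the `q`-Pascal rule leaves the terms of `oddSumB`, up to reflecting its second series by
`i ↦ -1 - i`, and two further series that cancel under `i ↦ -i`. -/
theorem evenSum_succ {q : ℂ} (hq0 : q ≠ 0) (hq1 : ‖q‖ < 1) (n : ℕ) :
    (1 - q ^ (2 * n + 2)) * evenSum q (n + 1) = q ^ (n + 1) * oddSumB q n := by
  have hA : (1 - q ^ (2 * n + 2)) *
      ∑' i : ℤ, q ^ (3 * i ^ 2 - i) * evenKernel q (n + 1) (3 * i + 0) =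
      ∑' i : ℤ, q ^ (3 * i ^ 2 - i) * oddKernel q n (3 * i + -1) +
        q ^ (n + 1) * ∑' i : ℤ, q ^ (3 * i ^ 2 + 2 * i) * oddKernel q n (3 * i + 0) := by
    rw [← tsum_mul_left, ← tsum_mul_left, ← (summable_mul_oddKernel q _ n (-1)).tsum_add
      ((summable_mul_oddKernel q _ n 0).mul_left _)]
    refine tsum_congr fun i => ?_
    rw [mul_left_comm, evenKernel_pascal hq0 hq1, mul_add, ← mul_assoc, ← zpow_add₀ hq0,
      ← mul_assoc, ← zpow_natCast, ← zpow_add₀ hq0]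
    push_cast
    congr 3 <;> ring
  have hB : (1 - q ^ (2 * n + 2)) *
      ∑' i : ℤ, q ^ (3 * i ^ 2 + i) * evenKernel q (n + 1) (3 * i + 1) =
      ∑' i : ℤ, q ^ (3 * i ^ 2 + i) * oddKernel q n (3 * i + 0) +
        q ^ (n + 1) * ∑' i : ℤ, q ^ (3 * i ^ 2 + 4 * i + 1) * oddKernel q n (3 * i + 1) := by
    rw [← tsum_mul_left, ← tsum_mul_left, ← (summable_mul_oddKernel q _ n 0).tsum_add
      ((summable_mul_oddKernel q _ n 1).mul_left _)]
    refine tsum_congr fun i => ?_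
    rw [mul_left_comm, evenKernel_pascal hq0 hq1, mul_add, ← mul_assoc, ← zpow_add₀ hq0,
      ← mul_assoc, ← zpow_natCast, ← zpow_add₀ hq0]
    push_cast
    congr 3 <;> ring
  have hC : ∑' i : ℤ, q ^ (3 * i ^ 2 + 4 * i + 1) * oddKernel q n (3 * i + 1) =
      ∑' i : ℤ, q ^ (3 * i ^ 2 + 2 * i) * oddKernel q n (3 * i + 1) := by
    rw [← (Equiv.subLeft (-1 : ℤ)).tsum_eq]
    refine tsum_congr fun i => ?_
    rw [Equiv.subLeft_apply, ← oddKernel_neg]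
    congr 2 <;> ring
  have hD : ∑' i : ℤ, q ^ (3 * i ^ 2 - i) * oddKernel q n (3 * i + -1) =
      ∑' i : ℤ, q ^ (3 * i ^ 2 + i) * oddKernel q n (3 * i + 0) := by
    rw [← (Equiv.neg ℤ).tsum_eq]
    refine tsum_congr fun i => ?_
    rw [Equiv.neg_apply, ← oddKernel_neg]
    congr 2 <;> ring
  rw [evenSum, oddSumB, mul_sub, hA, hB, hC, hD]
  ring

theorem evenSum_zero (q : ℂ) : evenSum q 0 = 1 := by
  have h : ∀ r : ℤ, r ≠ 0 → evenKernel q 0 r = 0 := fun r hr =>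
    evenKernel_eq_zero q (by simpa using hr)
  have h0 : evenKernel q 0 0 = 1 := by simp [evenKernel, recipPoch]
  have hB : ∑' i : ℤ, q ^ (3 * i ^ 2 + i) * evenKernel q 0 (3 * i + 1) = 0 := by
    have h1 : ∀ i : ℤ, evenKernel q 0 (3 * i + 1) = 0 := fun i => h _ (by omega)
    simp [h1]
  rw [evenSum, hB, tsum_eq_single 0 fun i hi => by rw [h _ (by omega), mul_zero]]
  simp [h0]

theorem evenSum_closed {q : ℂ} (hq0 : q ≠ 0) (hq1 : ‖q‖ < 1) (n : ℕ) :
    evenSum q n * qPoch q q (2 * n) = q ^ (n ^ 2) := by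
  induction n with
  | zero => simp [evenSum_zero]
  | succ n ih =>
    have h := oddSumB_eq hq0 hq1 n
    have h' := evenSum_succ hq0 hq1 n
    rw [show 2 * (n + 1) = 2 * n + 1 + 1 by ring, qPoch_self_succ, qPoch_self_succ]
    rw [show (n + 1) ^ 2 = (n + 1) + n + n ^ 2 by ring, pow_add q _ (n ^ 2), pow_add q (n + 1),
      ← ih]
    linear_combination qPoch q q (2 * n) * (1 - q ^ (2 * n + 1)) * h' +
      q ^ (n + 1) * qPoch q q (2 * n) * h

/-- A Bailey pair relative to `q` with `β_n = q^{n²} / (q; q)_{2n+1}`, up to normalization. -/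
theorem oddSumA_closed {q : ℂ} (hq0 : q ≠ 0) (hq1 : ‖q‖ < 1) (n : ℕ) :
    oddSumA q n = q ^ (n ^ 2) / qPoch q q (2 * n + 1) := by
  rw [eq_div_iff (qPoch_self_ne_zero hq1 _), ← evenSum_closed hq0 hq1, qPoch_self_succ,
    ← oddSumA_eq hq0 hq1]
  ring

/-- A Bailey pair relative to `q` with `β_n = q^{n²+n} / (q; q)_{2n+1}`, up to normalization. -/
theorem oddSumB_closed {q : ℂ} (hq0 : q ≠ 0) (hq1 : ‖q‖ < 1) (n : ℕ) :
    oddSumB q n = q ^ (n ^ 2 + n) / qPoch q q (2 * n + 1) := by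
  rw [eq_div_iff (qPoch_self_ne_zero hq1 _), pow_add, ← evenSum_closed hq0 hq1, qPoch_self_succ]
  linear_combination qPoch q q (2 * n) * oddSumB_eq hq0 hq1 n

/-! ### The conjugate Bailey sum -/

/-- `(-1)^n q^{n(n+1)/2} (q; q)_n`, the weight of the conjugate Bailey pair in use. -/
noncomputable def weight (q : ℂ) (n : ℕ) : ℂ :=
  (-1) ^ n * q ^ (n + 1).choose 2 * qPoch q q n

theorem choose_two_succ (n : ℕ) : (n + 2).choose 2 = (n + 1).choose 2 + (n + 1) := by
  rw [Nat.choose_succ_succ' (n + 1) 1, Nat.choose_one_right, add_comm]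

theorem le_choose_two_succ (n : ℕ) : n ≤ (n + 1).choose 2 := by
  induction n with
  | zero => simp
  | succ n ih => rw [choose_two_succ]; omega

theorem weight_succ (q : ℂ) (n : ℕ) :
    weight q (n + 1) = -(q ^ (n + 1) * (1 - q ^ (n + 1)) * weight q n) := by
  rw [weight, weight, choose_two_succ, qPoch_self_succ]
  ring

theorem exists_weight_bound {q : ℂ} (hq1 : ‖q‖ < 1) :
    ∃ K : ℝ, 0 < K ∧ ∀ n, ‖weight q n‖ ≤ K * ‖q‖ ^ n := by
  obtain ⟨K, hK, h, -⟩ := exists_recipPoch_bound hq1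
  refine ⟨K, hK, fun n => ?_⟩
  rw [weight, norm_mul, norm_mul, norm_pow, norm_pow, norm_neg, norm_one, one_pow, one_mul,
    mul_comm]
  exact mul_le_mul (h n)
    (pow_le_pow_of_le_one (norm_nonneg q) hq1.le (le_choose_two_succ n)) (by positivity) hK.le

/-- A bound on the terms of the double sum, uniform in the position `r`. -/
theorem exists_weight_mul_oddKernel_bound {q : ℂ} (hq1 : ‖q‖ < 1) :
    ∃ K : ℝ, 0 < K ∧ ∀ n r, ‖weight q n * oddKernel q n r‖ ≤ K * ‖q‖ ^ n := by
  obtain ⟨K, hK, h⟩ := exists_weight_bound hq1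
  obtain ⟨M, hM, -, h'⟩ := exists_recipPoch_bound hq1
  refine ⟨K * (M * M), by positivity, fun n r => ?_⟩
  rw [norm_mul, oddKernel, norm_mul]
  calc _ ≤ K * ‖q‖ ^ n * (M * M) := by gcongr <;> simp only [h, h']
    _ = _ := by ring

theorem summable_of_norm_le_geometric {q : ℂ} (hq1 : ‖q‖ < 1) {u : ℕ → ℂ} {K : ℝ}
    (h : ∀ n, ‖u n‖ ≤ K * ‖q‖ ^ n) : Summable u :=
  Summable.of_norm_bounded
    ((summable_geometric_of_lt_one (norm_nonneg q) hq1).mul_left K) h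

theorem tendsto_zero_of_norm_le_geometric {q : ℂ} (hq1 : ‖q‖ < 1) {u : ℕ → ℂ} {K : ℝ}
    (h : ∀ n, ‖u n‖ ≤ K * ‖q‖ ^ n) : Tendsto u atTop (𝓝 0) :=
  (summable_of_norm_le_geometric hq1 h).tendsto_atTop_zero

theorem summable_weight_mul_oddKernel {q : ℂ} (hq1 : ‖q‖ < 1) (r : ℤ) :
    Summable fun n => weight q n * oddKernel q n r := by
  obtain ⟨K, -, h⟩ := exists_weight_mul_oddKernel_bound hq1
  exact summable_of_norm_le_geometric hq1 fun n => h n r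

theorem tsum_eq_of_telescope {u T : ℕ → ℂ} (hu : Summable u) (h : ∀ n, u n = T (n + 1) - T n)
    (hT : Tendsto T atTop (𝓝 0)) : ∑' n, u n = -T 0 := by
  refine (hu.hasSum_iff_tendsto_nat.mpr ?_).tsum_eq
  simp only [h, Finset.sum_range_sub]
  simpa using hT.sub_const (T 0)

/-- `∑_n (-1)^n q^{n(n+1)/2} (q; q)_n / ((q; q)_{n-r} (q; q)_{n+r+1})`. -/
noncomputable def conjSum (q : ℂ) (r : ℤ) : ℂ :=
  ∑' n : ℕ, weight q n * oddKernel q n r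

theorem conjSum_neg (q : ℂ) (r : ℤ) : conjSum q (-r - 1) = conjSum q r := by
  simp only [conjSum, oddKernel_neg]

/-- At `r = 0` the summand telescopes: it is the difference in `n` of
`-(-1)^n q^{n(n+1)/2} / (q; q)_n`. -/
theorem conjSum_zero {q : ℂ} (hq1 : ‖q‖ < 1) : conjSum q 0 = 1 := by
  have hne := qPoch_self_ne_zero hq1
  have h : ∀ n, weight q n * oddKernel q n 0 =
      -(weight q (n + 1) * recipPoch q ((n + 1 : ℕ) : ℤ) * recipPoch q ((n + 1 : ℕ) : ℤ)) -
        -(weight q n * recipPoch q n * recipPoch q n) := by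
    intro n
    have h1 := one_sub_pow_ne_zero hq1 n.succ_ne_zero
    rw [weight_succ, oddKernel, sub_zero, add_zero, ← Nat.cast_succ]
    simp only [recipPoch_natCast]
    rw [weight, qPoch_self_succ]
    field_simp [hne n, h1]
    ring
  obtain ⟨K, hK, hw⟩ := exists_weight_bound hq1
  obtain ⟨M, hM, -, hr⟩ := exists_recipPoch_bound hq1
  rw [conjSum, tsum_eq_of_telescope (T := fun n : ℕ => -(weight q n * recipPoch q n * recipPoch q n))
    (summable_weight_mul_oddKernel hq1 0) h]
  · simp [weight, recipPoch]
  · refine tendsto_zero_of_norm_le_geometric hq1 (K := K * M * M) fun n => ?_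
    rw [norm_neg, norm_mul, norm_mul]
    calc _ ≤ K * ‖q‖ ^ n * M * M := by gcongr <;> simp only [hw, hr]
      _ = _ := by ring

/-- Creative telescoping: `g(n, r+1) + q^{r+1} g(n, r)` is the difference in `n` of
`-(1 + q^{r+1}) w_n / ((q; q)_{n-r-1} (q; q)_{n+r+1})`, where `w_n` is the weight and
`g(n, r)` the summand. -/
theorem conjSum_succ {q : ℂ} (hq0 : q ≠ 0) (hq1 : ‖q‖ < 1) (r : ℕ) :
    conjSum q (r + 1) = -(q ^ (r + 1) * conjSum q r) := by
  have h : ∀ n, weight q n * oddKernel q n (r + 1) +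
      q ^ (r + 1) * (weight q n * oddKernel q n r) =
      -((1 + q ^ (r + 1)) * (weight q (n + 1) *
        (recipPoch q ((n + 1 : ℕ) - r - 1) * recipPoch q ((n + 1 : ℕ) + r + 1)))) -
      -((1 + q ^ (r + 1)) * (weight q n *
        (recipPoch q (n - r - 1) * recipPoch q (n + r + 1)))) := by
    intro n
    have e1 : recipPoch q (n - r - 1) = (1 - q ^ ((n : ℤ) - r)) * recipPoch q (n - r) :=
      recipPoch_sub_one hq1 _
    have e2 : recipPoch q (n + r + 1) =
        (1 - q ^ ((n : ℤ) + r + 2)) * recipPoch q (n + r + 2) := by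
      rw [← recipPoch_sub_one hq1]; congr 1; ring
    rw [weight_succ, oddKernel, oddKernel,
      show (n : ℤ) - (r + 1) = n - r - 1 by ring, show (n : ℤ) + (r + 1) + 1 = n + r + 2 by ring,
      show ((n + 1 : ℕ) : ℤ) - r - 1 = n - r by push_cast; ring,
      show ((n + 1 : ℕ) : ℤ) + r + 1 = n + r + 2 by push_cast; ring, e1, e2,
      show (n : ℤ) + r + 2 = ((n + r + 2 : ℕ) : ℤ) by push_cast; ring, zpow_sub₀ hq0]
    simp only [zpow_natCast]
    field_simp
    ring
  obtain ⟨K, hK, hw⟩ := exists_weight_bound hq1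
  obtain ⟨M, hM, -, hr⟩ := exists_recipPoch_bound hq1
  have hs := summable_weight_mul_oddKernel hq1 r
  have hs' := summable_weight_mul_oddKernel hq1 (r + 1)
  have key := tsum_eq_of_telescope (T := fun n : ℕ => -((1 + q ^ (r + 1)) * (weight q n *
    (recipPoch q (n - r - 1) * recipPoch q (n + r + 1))))) (hs'.add (hs.mul_left (q ^ (r + 1)))) h <| by
    refine tendsto_zero_of_norm_le_geometric hq1
      (K := ‖1 + q ^ (r + 1)‖ * (K * (M * M))) fun n => ?_
    rw [norm_neg, norm_mul, norm_mul, norm_mul]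
    calc _ ≤ ‖1 + q ^ (r + 1)‖ * (K * ‖q‖ ^ n * (M * M)) := by gcongr <;> simp only [hw, hr]
      _ = _ := by ring
  beta_reduce at key
  rw [hs'.tsum_add (hs.mul_left _), tsum_mul_left,
    recipPoch_of_neg q (k := ((0 : ℕ) : ℤ) - r - 1) (by push_cast; omega)] at key
  rw [conjSum, conjSum, eq_neg_iff_add_eq_zero, key]
  simp

/-- The conjugate Bailey sum, a case of the `₁φ₁` summation. -/
theorem conjSum_natCast {q : ℂ} (hq0 : q ≠ 0) (hq1 : ‖q‖ < 1) (r : ℕ) :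
    conjSum q r = (-1) ^ r * q ^ (r + 1).choose 2 := by
  induction r with
  | zero => simpa using conjSum_zero hq1
  | succ r ih =>
    rw [Nat.cast_succ, conjSum_succ hq0 hq1, ih, choose_two_succ]
    ring

/-! ### Interchange of the summations and evaluation -/

theorem summable_zpow_of_abs_le {q : ℂ} (hq0 : q ≠ 0) (hq1 : ‖q‖ < 1) {e : ℤ → ℤ}
    (he : ∀ i, |i| ≤ e i) : Summable fun i => q ^ e i := by
  have hg : Summable fun i : ℤ => ‖q‖ ^ i.natAbs := by
    have h := summable_geometric_of_lt_one (norm_nonneg q) hq1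
    exact Summable.of_nat_of_neg (by simpa using h) (by simpa using h)
  refine Summable.of_norm_bounded hg fun i => ?_
  rw [norm_zpow, ← zpow_natCast, Int.natCast_natAbs]
  exact zpow_le_zpow_right_of_le_one₀ (norm_pos_iff.mpr hq0) hq1.le (he i)

/-- Absolute convergence of the double series behind the Bailey lemma. -/
theorem summable_weight_mul_coeff {q : ℂ} (hq1 : ‖q‖ < 1) {c : ℤ → ℂ} (hc : Summable c) (s : ℤ) :
    Summable fun p : ℕ × ℤ => weight q p.1 * (c p.2 * oddKernel q p.1 (3 * p.2 + s)) := by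
  obtain ⟨K, hK, h⟩ := exists_weight_mul_oddKernel_bound hq1
  have hg : Summable fun p : ℕ × ℤ => K * ‖q‖ ^ p.1 * ‖c p.2‖ :=
    ((summable_geometric_of_lt_one (norm_nonneg q) hq1).mul_left K).mul_of_nonneg hc.norm
      (fun n => by positivity) (fun i => by positivity)
  refine Summable.of_norm_bounded hg fun p => ?_
  rw [mul_left_comm, norm_mul, mul_comm]
  exact mul_le_mul_of_nonneg_right (h _ _) (norm_nonneg _)

theorem summable_coeff_mul_conjSum {q : ℂ} (hq1 : ‖q‖ < 1) {c : ℤ → ℂ} (hc : Summable c)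
    (s : ℤ) : Summable fun i : ℤ => c i * conjSum q (3 * i + s) := by
  refine (summable_weight_mul_coeff hq1 hc s).prod_symm.prod.congr fun i => ?_
  simp only [Prod.swap_prod_mk, conjSum, ← tsum_mul_left]
  exact tsum_congr fun n => mul_left_comm _ _ _

/-- The Bailey lemma for the weight `w_n = (-1)^n q^{n(n+1)/2} (q; q)_n`: summing over `n` first
replaces each kernel by its conjugate Bailey sum. -/
theorem hasSum_weight_mul_tsum {q : ℂ} (hq1 : ‖q‖ < 1) {c : ℤ → ℂ} (hc : Summable c) (s : ℤ) :
    HasSum (fun n => weight q n * ∑' i : ℤ, c i * oddKernel q n (3 * i + s))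
      (∑' i : ℤ, c i * conjSum q (3 * i + s)) := by
  have hF := summable_weight_mul_coeff hq1 hc s
  have h1 : ∑' i : ℤ, c i * conjSum q (3 * i + s) =
      ∑' (n : ℕ) (i : ℤ), weight q n * (c i * oddKernel q n (3 * i + s)) := by
    refine Eq.trans (tsum_congr fun i => ?_) (Summable.tsum_comm
      (f := fun n i => weight q n * (c i * oddKernel q n (3 * i + s))) hF)
    rw [conjSum, ← tsum_mul_left]
    exact tsum_congr fun n => mul_left_comm _ _ _
  rw [h1]
  simp only [← tsum_mul_left]
  exact hF.prod.hasSum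

theorem two_mul_choose_two_succ (n : ℕ) : 2 * (n + 1).choose 2 = n * (n + 1) := by
  induction n with
  | zero => simp
  | succ n ih => rw [choose_two_succ, mul_add, ih]; ring

/-- Comparison of exponents: `2e + r(r+1)` is twice the exponent on the left, and the exponent
on the right is `b + a n + 15 n(n+1)/2`. -/
theorem zpow_mul_conjSum {q : ℂ} (hq0 : q ≠ 0) (hq1 : ‖q‖ < 1) {e a : ℤ} {b n r : ℕ}
    (h : 2 * e + r * (r + 1) = 2 * b + 2 * (a * n) + 15 * (n * (n + 1))) :
    q ^ e * conjSum q r = (-1) ^ (r + n) * (q ^ b * partialThetaTerm a q n) := by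
  have h1 : (2 * (r + 1).choose 2 : ℤ) = r * (r + 1) := mod_cast two_mul_choose_two_succ r
  have h2 : (2 * (n + 1).choose 2 : ℤ) = n * (n + 1) := mod_cast two_mul_choose_two_succ n
  have he : e + ((r + 1).choose 2 : ℕ) = b + a * n + (15 * (n + 1).choose 2 : ℕ) := by
    push_cast
    linarith
  have hs : ((-1 : ℂ) ^ n) * (-1) ^ n = 1 := by rw [← mul_pow]; simp
  have hz := congrArg (fun k : ℤ => q ^ k) he
  simp only [zpow_add₀ hq0, zpow_natCast] at hz
  rw [conjSum_natCast hq0 hq1, partialThetaTerm, pow_add]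
  linear_combination (-1) ^ r * hz - (-1) ^ r * q ^ b * q ^ (a * n) *
    q ^ (15 * (n + 1).choose 2) * hs

/-- The negative half of the bilateral sum is folded back by the symmetry `r ↦ -r - 1`. -/
theorem tsum_coeff_mul_conjSum {q : ℂ} (hq1 : ‖q‖ < 1) {c : ℤ → ℂ} (hc : Summable c) (s : ℤ) :
    ∑' i : ℤ, c i * conjSum q (3 * i + s) = ∑' n : ℕ, c n * conjSum q (3 * n + s) +
      ∑' n : ℕ, c (-(n + 1)) * conjSum q (3 * n + 2 - s) := by
  have h := summable_coeff_mul_conjSum hq1 hc s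
  have h1 : Summable fun n : ℕ => c n * conjSum q (3 * n + s) :=
    h.comp_injective Nat.cast_injective
  have h2 : Summable fun n : ℕ => c (-(n + 1)) * conjSum q (3 * -(n + 1) + s) :=
    h.comp_injective (i := fun n : ℕ => -((n : ℤ) + 1)) fun a b hab => by simpa using hab
  rw [tsum_of_nat_of_neg_add_one (f := fun i : ℤ => c i * conjSum q (3 * i + s)) h1 h2]
  congr 1
  refine tsum_congr fun n => ?_
  rw [← conjSum_neg]
  congr 2; ring

/-- The positions `3i` contribute `r = 3n` for `i = n ≥ 0` and `r = 3n + 2` for `i = -(n+1)`; each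
half is a partial theta function, the two hypotheses comparing twice the exponents. -/
theorem tsum_conjSum_zero {q : ℂ} (hq0 : q ≠ 0) (hq1 : ‖q‖ < 1) {e : ℤ → ℤ} {a a' : ℤ} {b b' : ℕ}
    (he : ∀ i, |i| ≤ e i)
    (h : ∀ n : ℕ, 2 * e n + 3 * n * (3 * n + 1) = 2 * b + 2 * (a * n) + 15 * (n * (n + 1)))
    (h' : ∀ n : ℕ, 2 * e (-(n + 1)) + (3 * n + 2) * (3 * n + 3) =
      2 * b' + 2 * (a' * n) + 15 * (n * (n + 1))) :
    ∑' i : ℤ, q ^ e i * conjSum q (3 * i + 0) =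
      q ^ b * partialTheta a q + q ^ b' * partialTheta a' q := by
  rw [tsum_coeff_mul_conjSum hq1 (summable_zpow_of_abs_le hq0 hq1 he), partialTheta, partialTheta,
    ← tsum_mul_left, ← tsum_mul_left]
  congr 1 <;> refine tsum_congr fun n => ?_
  · rw [show (3 * n + 0 : ℤ) = ((3 * n : ℕ) : ℤ) by push_cast; ring,
      zpow_mul_conjSum hq0 hq1 (by push_cast; exact h n), Even.neg_one_pow ⟨2 * n, by ring⟩,
      one_mul]
  · rw [show (3 * n + 2 - 0 : ℤ) = ((3 * n + 2 : ℕ) : ℤ) by push_cast; ring,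
      zpow_mul_conjSum (a := a') (b := b') (n := n) hq0 hq1
        (by push_cast; linarith [h' n]),
      Even.neg_one_pow ⟨2 * n + 1, by ring⟩, one_mul]

/-- The positions `3i + 1` contribute `r = 3n + 1` both for `i = n ≥ 0` and for `i = -(n+1)`. -/
theorem tsum_conjSum_one {q : ℂ} (hq0 : q ≠ 0) (hq1 : ‖q‖ < 1) {e : ℤ → ℤ} {a a' : ℤ} {b b' : ℕ}
    (he : ∀ i, |i| ≤ e i)
    (h : ∀ n : ℕ, 2 * e n + (3 * n + 1) * (3 * n + 2) =
      2 * b + 2 * (a * n) + 15 * (n * (n + 1)))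
    (h' : ∀ n : ℕ, 2 * e (-(n + 1)) + (3 * n + 1) * (3 * n + 2) =
      2 * b' + 2 * (a' * n) + 15 * (n * (n + 1))) :
    ∑' i : ℤ, q ^ e i * conjSum q (3 * i + 1) =
      -(q ^ b * partialTheta a q + q ^ b' * partialTheta a' q) := by
  rw [tsum_coeff_mul_conjSum hq1 (summable_zpow_of_abs_le hq0 hq1 he), neg_add, partialTheta,
    partialTheta, ← tsum_mul_left, ← tsum_mul_left, ← tsum_neg, ← tsum_neg]
  congr 1 <;> refine tsum_congr fun n => ?_
  · rw [show (3 * n + 1 : ℤ) = ((3 * n + 1 : ℕ) : ℤ) by push_cast; ring,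
      zpow_mul_conjSum (a := a) (b := b) (n := n) hq0 hq1
        (by push_cast; linarith [h n]),
      Odd.neg_one_pow ⟨2 * n, by ring⟩, neg_one_mul]
  · rw [show (3 * n + 2 - 1 : ℤ) = ((3 * n + 1 : ℕ) : ℤ) by push_cast; ring,
      zpow_mul_conjSum (a := a') (b := b') (n := n) hq0 hq1
        (by push_cast; linarith [h' n]),
      Odd.neg_one_pow ⟨2 * n, by ring⟩, neg_one_mul]

theorem abs_le_three_mul_sq_add {i k : ℤ} (hk : |k| ≤ 2) : |i| ≤ 3 * i ^ 2 + k * i := by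
  have h1 : |i| ≤ i ^ 2 := by
    rw [← sq_abs]
    rcases (abs_nonneg i).eq_or_lt with h | h
    · simp [← h]
    · nlinarith
  have h2 : -(2 * |i|) ≤ k * i := by
    have h3 := neg_abs_le (k * i)
    rw [abs_mul] at h3
    nlinarith [abs_nonneg i]
  linarith

theorem hasSum_weight_mul_oddSumA {q : ℂ} (hq0 : q ≠ 0) (hq1 : ‖q‖ < 1) :
    HasSum (fun n => weight q n * oddSumA q n)
      (partialTheta (-7) q + q ^ 7 * partialTheta 7 q +
        (q * partialTheta (-2) q + q ^ 3 * partialTheta 2 q)) := by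
  have he : ∀ i : ℤ, |i| ≤ 3 * i ^ 2 - i := fun i =>
    (abs_le_three_mul_sq_add (k := -1) (by norm_num)).trans_eq (by ring)
  have he' : ∀ i : ℤ, |i| ≤ 3 * i ^ 2 + i := fun i =>
    (abs_le_three_mul_sq_add (k := 1) (by norm_num)).trans_eq (by ring)
  have h := (hasSum_weight_mul_tsum hq1 (summable_zpow_of_abs_le hq0 hq1 he) 0).sub
    (hasSum_weight_mul_tsum hq1 (summable_zpow_of_abs_le hq0 hq1 he') 1)
  rw [tsum_conjSum_zero (a := -7) (a' := 7) (b := 0) (b' := 7) hq0 hq1 he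
      (fun n => by push_cast; ring) (fun n => by push_cast; ring),
    tsum_conjSum_one (a := -2) (a' := 2) (b := 1) (b' := 3) hq0 hq1 he'
      (fun n => by push_cast; ring) (fun n => by push_cast; ring),
    sub_neg_eq_add, pow_zero, pow_one, one_mul] at h
  simpa only [oddSumA, mul_sub] using h

theorem hasSum_weight_mul_oddSumB {q : ℂ} (hq0 : q ≠ 0) (hq1 : ‖q‖ < 1) :
    HasSum (fun n => weight q n * oddSumB q n)
      (partialTheta (-4) q + q ^ 4 * partialTheta 4 q +
        (q * partialTheta (-1) q + q ^ 2 * partialTheta 1 q)) := by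
  have he : ∀ i : ℤ, |i| ≤ 3 * i ^ 2 + 2 * i := fun i => abs_le_three_mul_sq_add (by norm_num)
  have hc := summable_zpow_of_abs_le hq0 hq1 he
  have h := (hasSum_weight_mul_tsum hq1 hc 0).sub (hasSum_weight_mul_tsum hq1 hc 1)
  rw [tsum_conjSum_zero (a := -4) (a' := 4) (b := 0) (b' := 4) hq0 hq1 he
      (fun n => by push_cast; ring) (fun n => by push_cast; ring),
    tsum_conjSum_one (a := -1) (a' := 1) (b := 1) (b' := 2) hq0 hq1 he
      (fun n => by push_cast; ring) (fun n => by push_cast; ring),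
    sub_neg_eq_add, pow_zero, pow_one, one_mul] at h
  simpa only [oddSumB, mul_sub] using h

/-! ### The Eulerian series and their duals -/

theorem summable_partialThetaTerm {q : ℂ} (hq0 : q ≠ 0) (hq1 : ‖q‖ < 1) (a : ℤ) :
    Summable (partialThetaTerm a q) := by
  refine summable_of_norm_le_geometric hq1 (K := ‖q‖ ^ (-a ^ 2)) fun n => ?_
  have hpos := norm_pos_iff.mpr hq0
  rw [partialThetaTerm, norm_mul, norm_mul, norm_pow, norm_neg, norm_one, one_pow, one_mul,
    norm_zpow, norm_pow, ← zpow_natCast, ← zpow_natCast, ← zpow_add₀ hpos.ne',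
    ← zpow_add₀ hpos.ne']
  refine zpow_le_zpow_right_of_le_one₀ hpos hq1.le ?_
  have h2 : (2 * (n + 1).choose 2 : ℤ) = n * (n + 1) := mod_cast two_mul_choose_two_succ n
  push_cast
  -- the exponent `a n + 15 n(n+1)/2` is at least `n - a²`
  nlinarith [sq_nonneg (a + n), sq_nonneg (a : ℤ), sq_nonneg (n : ℤ)]

/-- Inverting the base: each factor `1 - q^{-k}` equals `-q^{-k} (1 - q^k)`. -/
theorem qPoch_inv {q : ℂ} (hq0 : q ≠ 0) (n m : ℕ) :
    qPoch (q⁻¹ ^ (n + 1)) q⁻¹ m * ((-1) ^ m * q ^ (m * (n + 1) + m.choose 2)) =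
      qPoch (q ^ (n + 1)) q m := by
  induction m with
  | zero => simp
  | succ m ih =>
    have h : (1 - q⁻¹ ^ m * q⁻¹ ^ (n + 1)) * q ^ (m + (n + 1)) =
        -(1 - q ^ m * q ^ (n + 1)) := by
      rw [← pow_add, ← pow_add, sub_mul, ← mul_pow, inv_mul_cancel₀ hq0]
      ring
    rw [qPoch_succ, qPoch_succ, ← ih, Nat.choose_succ_succ' m 1, Nat.choose_one_right,
      show (m + 1) * (n + 1) + (m + m.choose 2) = m * (n + 1) + m.choose 2 + (m + (n + 1)) by ring,
      pow_add q _ (m + (n + 1)), pow_succ (-1 : ℂ)]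
    linear_combination -qPoch (q⁻¹ ^ (n + 1)) q⁻¹ m * (-1) ^ m *
      q ^ (m * (n + 1) + m.choose 2) * h

theorem inv_pow_div_qPoch_inv {q : ℂ} (hq0 : q ≠ 0) (hq1 : ‖q‖ < 1) {n m k l : ℕ}
    (h : k + l = m * (n + 1) + m.choose 2) :
    q⁻¹ ^ k / qPoch (q⁻¹ ^ (n + 1)) q⁻¹ m = (-1) ^ m * q ^ l / qPoch (q ^ (n + 1)) q m := by
  have h1 := qPoch_inv hq0 n m
  have h2 := qPoch_pow_ne_zero hq1 n m
  have h3 : qPoch (q⁻¹ ^ (n + 1)) q⁻¹ m ≠ 0 := fun h0 => h2 (by rw [← h1, h0, zero_mul])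
  have h4 : q⁻¹ ^ k * q ^ k = 1 := by rw [← mul_pow, inv_mul_cancel₀ hq0, one_pow]
  rw [div_eq_div_iff h3 h2, ← h1, ← h, pow_add q k l]
  linear_combination qPoch (q⁻¹ ^ (n + 1)) q⁻¹ m * (-1) ^ m * q ^ l * h4

/-- The integer division in the exponent is exact. -/
theorem three_mul_sq_sub_ediv_two (n : ℕ) :
    (3 * (n : ℤ) ^ 2 - n) / 2 = ((n ^ 2 + n.choose 2 : ℕ) : ℤ) := by
  have h2 : (2 * (n + 1).choose 2 : ℤ) = n * (n + 1) := mod_cast two_mul_choose_two_succ n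
  rw [Nat.choose_succ_succ' n 1, Nat.choose_one_right] at h2
  refine Int.ediv_eq_of_eq_mul_left two_ne_zero ?_
  push_cast at h2 ⊢
  linarith

/-- The integer division in the exponent is exact. -/
theorem three_mul_sq_add_ediv_two (n : ℕ) :
    (3 * (n : ℤ) ^ 2 + n) / 2 = ((n ^ 2 + (n + 1).choose 2 : ℕ) : ℤ) := by
  have h2 : (2 * (n + 1).choose 2 : ℤ) = n * (n + 1) := mod_cast two_mul_choose_two_succ n
  refine Int.ediv_eq_of_eq_mul_left two_ne_zero ?_
  push_cast
  linarith

theorem chi0TermA_inv {q : ℂ} (hq0 : q ≠ 0) (hq1 : ‖q‖ < 1) (n : ℕ) :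
    chi0TermA q⁻¹ n = chi0DualTermA q n := by
  rw [chi0TermA, chi0DualTermA, three_mul_sq_sub_ediv_two, zpow_natCast]
  exact inv_pow_div_qPoch_inv hq0 hq1 (by ring)

theorem chi0TermB_inv {q : ℂ} (hq0 : q ≠ 0) (hq1 : ‖q‖ < 1) (n : ℕ) :
    chi0TermB q⁻¹ n = chi0DualTermB q n := by
  rw [chi0TermB, chi0DualTermB, three_mul_sq_add_ediv_two, zpow_natCast]
  exact inv_pow_div_qPoch_inv hq0 hq1 (by ring)

theorem chi1TermA_inv {q : ℂ} (hq0 : q ≠ 0) (hq1 : ‖q‖ < 1) (n : ℕ) :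
    chi1TermA q⁻¹ n = chi1DualTermA q n := by
  rw [chi1TermA, chi1DualTermA]
  exact inv_pow_div_qPoch_inv hq0 hq1 (by linarith [two_mul_choose_two_succ n])

theorem inv_qPoch_pow {q : ℂ} (hq1 : ‖q‖ < 1) (n m : ℕ) :
    (qPoch (q ^ (n + 1)) q m)⁻¹ = qPoch q q n / qPoch q q (n + m) := by
  rw [← qPoch_self_mul]
  field_simp [qPoch_self_ne_zero hq1 n, qPoch_pow_ne_zero hq1 n m]

theorem chi0DualTermA_eq {q : ℂ} (hq1 : ‖q‖ < 1) (n : ℕ) :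
    chi0DualTermA q n =
      (-1) ^ n * q ^ (n ^ 2 + n.choose 2) * (qPoch q q n / qPoch q q (2 * n)) := by
  rw [chi0DualTermA, three_mul_sq_sub_ediv_two, zpow_natCast, div_eq_mul_inv, inv_qPoch_pow hq1,
    two_mul]

theorem chi0DualTermB_eq {q : ℂ} (hq0 : q ≠ 0) (hq1 : ‖q‖ < 1) (n : ℕ) :
    chi0DualTermB q n = -(weight q n * oddSumA q n) := by
  rw [chi0DualTermB, three_mul_sq_add_ediv_two, zpow_natCast, div_eq_mul_inv, inv_qPoch_pow hq1,
    oddSumA_closed hq0 hq1, weight, show n + (n + 1) = 2 * n + 1 by ring]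
  ring

theorem chi1DualTermA_eq {q : ℂ} (hq0 : q ≠ 0) (hq1 : ‖q‖ < 1) (n : ℕ) :
    chi1DualTermA q n = -(q * (weight q n * oddSumB q n)) := by
  rw [chi1DualTermA, div_eq_mul_inv, inv_qPoch_pow hq1,
    oddSumB_closed hq0 hq1, weight, show n + (n + 1) = 2 * n + 1 by ring,
    show n ^ 2 + n = 2 * (n + 1).choose 2 by rw [two_mul_choose_two_succ]; ring]
  ring

/-- The two dual forms of `χ₀` differ by a telescoping series: `A_n - B_n` is the difference of
`-(1 + q^n) A_n`. -/
theorem chi0DualTermA_sub_chi0DualTermB {q : ℂ} (hq0 : q ≠ 0) (hq1 : ‖q‖ < 1) (n : ℕ) :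
    chi0DualTermA q n - chi0DualTermB q n =
      -((1 + q ^ (n + 1)) * chi0DualTermA q (n + 1)) - -((1 + q ^ n) * chi0DualTermA q n) := by
  have h0 := qPoch_self_ne_zero hq1 (2 * n)
  have h1 := one_sub_pow_ne_zero hq1 (2 * n).succ_ne_zero
  have h2 := one_sub_pow_ne_zero hq1 (2 * n + 1).succ_ne_zero
  rw [chi0DualTermB_eq hq0 hq1, oddSumA_closed hq0 hq1, chi0DualTermA_eq hq1,
    chi0DualTermA_eq hq1, weight, Nat.choose_succ_succ' n 1, Nat.choose_one_right,
    show 2 * (n + 1) = 2 * n + 1 + 1 by ring, qPoch_self_succ q (2 * n + 1),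
    qPoch_self_succ q (2 * n), qPoch_self_succ q n]
  -- cancels the factor `1 - q^{n+1}` contributed by `(q; q)_{n+1}`
  rw [show 1 - q ^ (2 * n + 1 + 1) = (1 - q ^ (n + 1)) * (1 + q ^ (n + 1)) by ring] at h2 ⊢
  obtain ⟨h3, h4⟩ := mul_ne_zero_iff.mp h2
  field_simp
  ring

theorem exists_chi0DualTermA_bound {q : ℂ} (hq1 : ‖q‖ < 1) :
    ∃ K : ℝ, 0 < K ∧ ∀ n, ‖chi0DualTermA q n‖ ≤ K * ‖q‖ ^ n := by
  obtain ⟨K, hK, h⟩ := exists_qPoch_self_bound hq1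
  refine ⟨K * K, by positivity, fun n => ?_⟩
  rw [chi0DualTermA_eq hq1, norm_mul, norm_mul, norm_pow, norm_pow, norm_neg, norm_one, one_pow,
    one_mul, div_eq_mul_inv, norm_mul, mul_comm]
  have hn : n ≤ n ^ 2 + n.choose 2 := (Nat.le_self_pow two_ne_zero n).trans (Nat.le_add_right _ _)
  exact mul_le_mul (mul_le_mul (h _).1 (h _).2 (norm_nonneg _) hK.le)
    (pow_le_pow_of_le_one (norm_nonneg q) hq1.le hn) (by positivity) (by positivity)

theorem tsum_chi0DualTermA {q : ℂ} (hq0 : q ≠ 0) (hq1 : ‖q‖ < 1)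
    (hB : Summable (chi0DualTermB q)) :
    Summable (chi0DualTermA q) ∧
      ∑' n, chi0DualTermA q n = 2 + ∑' n, chi0DualTermB q n := by
  obtain ⟨K, hK, h⟩ := exists_chi0DualTermA_bound hq1
  have hA := summable_of_norm_le_geometric hq1 h
  refine ⟨hA, ?_⟩
  have ht : Tendsto (fun n => -((1 + q ^ n) * chi0DualTermA q n)) atTop (𝓝 0) := by
    simpa using (((tendsto_pow_atTop_nhds_zero_of_norm_lt_one hq1).const_add 1).mul
      hA.tendsto_atTop_zero).neg
  have key := tsum_eq_of_telescope (hA.sub hB) (chi0DualTermA_sub_chi0DualTermB hq0 hq1) ht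
  rw [hA.tsum_sub hB, sub_eq_iff_eq_add] at key
  rw [key, chi0DualTermA_eq hq1]
  norm_num

theorem mainTheorem2 (q : ℂ) (hq0 : q ≠ 0) (hq1 : ‖q‖ < 1) :
    -- all the partial theta series converge
    (∀ a : ℤ, Summable (partialThetaTerm a q)) ∧
    -- dual of the first Eulerian form of the function chi_0
    ((∀ n : ℕ, chi0TermA q⁻¹ n = chi0DualTermA q n) ∧
      Summable (chi0DualTermA q) ∧
      ∑' n : ℕ, chi0DualTermA q n =
        2 - partialTheta (-7) q - q ^ 7 * partialTheta 7 q
          - q * partialTheta (-2) q - q ^ 3 * partialTheta 2 q) ∧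
    -- dual of the second Eulerian form of the function chi_0
    ((∀ n : ℕ, chi0TermB q⁻¹ n = chi0DualTermB q n) ∧
      Summable (chi0DualTermB q) ∧
      1 + ∑' n : ℕ, chi0DualTermB q n =
        1 - partialTheta (-7) q - q ^ 7 * partialTheta 7 q
          - q * partialTheta (-2) q - q ^ 3 * partialTheta 2 q) ∧
    -- dual of the first Eulerian form of the function chi_1
    ((∀ n : ℕ, chi1TermA q⁻¹ n = chi1DualTermA q n) ∧
      Summable (chi1DualTermA q) ∧
      ∑' n : ℕ, chi1DualTermA q n =
        - (q * partialTheta (-4) q) - q ^ 5 * partialTheta 4 q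
          - q ^ 2 * partialTheta (-1) q - q ^ 3 * partialTheta 1 q) := by
  refine ⟨summable_partialThetaTerm hq0 hq1, ⟨chi0TermA_inv hq0 hq1, ?_⟩,
    ⟨chi0TermB_inv hq0 hq1, ?_⟩, ⟨chi1TermA_inv hq0 hq1, ?_⟩⟩
  · have hB := (hasSum_weight_mul_oddSumA hq0 hq1).neg
    simp only [← chi0DualTermB_eq hq0 hq1] at hB
    obtain ⟨hA, h⟩ := tsum_chi0DualTermA hq0 hq1 hB.summable
    refine ⟨hA, ?_⟩
    rw [h, hB.tsum_eq]
    ring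
  · have hB := (hasSum_weight_mul_oddSumA hq0 hq1).neg
    simp only [← chi0DualTermB_eq hq0 hq1] at hB
    refine ⟨hB.summable, ?_⟩
    rw [hB.tsum_eq]
    ring
  · have h := ((hasSum_weight_mul_oddSumB hq0 hq1).mul_left q).neg
    simp only [← chi1DualTermA_eq hq0 hq1] at h
    refine ⟨h.summable, ?_⟩
    rw [h.tsum_eq]
    ring
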